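/- Let $d\ge 1$, let $\mathbb S^d\subset\mathbb R^{d+1}$ be the unit sphere with geodesic distance $2\arcsin(\|x-y\|/2)$, and let $X\subset\mathbb S^d$ be finite. The Delaunay complex $\mathrm{Del}(X)$ is the simplicial complex whose maximal simplices are the sets of $d+1$ points of $X$ lying on a geodesic sphere of $\mathbb S^d$ whose open geodesic ball contains no point of $X$; for a complex $K$ with vertices in $\mathbb R^{d+1}$, $|K|$ denotes the union of the convex hulls of its simplices. (No general position assumption on the points is needed.) The Delaunay barycentric (resp. edgewise) subdivision of $K$ is $\mathrm{Del}(X')$, where $X'$ is obtained by normalizing to unit length the barycenters of all simplices of $K$ (resp. the vertices of $K$ and the midpoints of its edges). Suppose that $K=\mathrm{Del}(X)$ is such that the radial projection $|K|\to\mathbb S^d$, $x\mapsto x/\|x\|$, is a well-defined homeomorphism, and let $\delta$ be the maximal Euclidean length of an edge of $K$. Put $$\ell(\delta)=1-\sqrt{1-\tfrac12\tfrac{d}{d+1}\delta^2}.$$ Let $L$ be a finite geometric simplicial complex in some $\mathbb R^n$ and $F\colon\mathbb S^d\to|L|$ a continuous map. For a complex $K'$ with vertices in $\mathbb R^{d+1}$,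 let $f(x)=F(x/\|x\|)$ for $0\neq x\in|K'|$. One says that $f$ satisfies the star condition (resp. the weak star condition) on $K'$ if for every vertex $v$ of $K'$ there is a vertex $w$ of $L$ such that $f$ is defined on the closed star of $v$ (resp. on the set consisting of $v$ and its neighbours) and maps it into the open star of $w$. A weak simplicial approximation to $f$ on $K'$ is a map $g$ from the vertices of $K'$ to those of $L$ such that for each vertex $v$ of $K'$, $f$ maps $v$ and its neighbours into the open star of $g(v)$. Consider Algorithm 2: starting with $K'=K$, while $f$ does not satisfy the star condition on $K'$, replace $K'$ by its subdivision; then return a weak simplicial approximation to $f$ on the final $K'$. 1. With Delaunay barycentric subdivisions, Algorithm 2 terminates (after finitely many iterations, with an output), provided that $d\le 3$ and $$\delta^{-1}\ell(\delta)\le\tfrac14\Big(1-\sqrt2\,\big(\tfrac{d}{d+1}\big)^{3/2}\Big).$$ 2. With Delaunay edgewise subdivisions, Algorithm 2 terminates, provided that $d\le 2$ and $\delta\le\tfrac12$. In both cases the same holds if the loop is run only until the weak star condition is satisfied. -/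

import Mathlib

noncomputable section

namespace SphericalDelaunay

/-- The Euclidean space `ℝ^(d+1)` containing the sphere `S^d`. -/
abbrev Amb (d : ℕ) := EuclideanSpace ℝ (Fin (d + 1))

/-- The unit sphere `S^d ⊂ ℝ^(d+1)`. -/
abbrev Sph (d : ℕ) : Set (Amb d) := Metric.sphere (0 : Amb d) 1

/-! ### Combinatorics and realizations of simplicial complexes -/

section Complexes

variable {V : Type*}

/-- The vertices of an abstract simplicial complex. -/
def vertexSet (K : PreAbstractSimplicialComplex V) : Set V :=
  {v | {v} ∈ K.faces}

/-- `[u, v]` is an edge of `K`. -/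
def IsEdge (K : PreAbstractSimplicialComplex V) (u v : V) : Prop :=
  u ≠ v ∧ ∃ s ∈ K.faces, u ∈ s ∧ v ∈ s

/-- The open star of `v`: the simplices containing `v`. -/
def openStar (K : PreAbstractSimplicialComplex V) (v : V) : Set (Finset V) :=
  {s | s ∈ K.faces ∧ v ∈ s}

/-- The closed star of `v`: the smallest subcomplex containing the open star of `v`, that is, all
the faces of the simplices containing `v`. -/
def closedStar (K : PreAbstractSimplicialComplex V) (v : V) : Set (Finset V) :=
  {t | t ∈ K.faces ∧ ∃ s ∈ openStar K v, t ⊆ s}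

variable [AddCommGroup V] [Module ℝ V]

/-- The interior of the simplex spanned by `s`: the points all of whose barycentric coordinates
are positive. -/
def openSimplex (s : Finset V) : Set V :=
  {x | ∃ c : V → ℝ, (∀ v ∈ s, 0 < c v) ∧ ∑ v ∈ s, c v = 1 ∧ ∑ v ∈ s, c v • v = x}

/-- The subset `|St(w)|` of `|L|` : the union of the interiors of the simplices containing `w`. -/
def openStarSpace (L : PreAbstractSimplicialComplex V) (w : V) : Set V :=
  ⋃ s ∈ openStar L w, openSimplex s

/-- The subset of `V` covered by the (closed) simplices with vertex sets in `T`. -/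
def underlying (T : Set (Finset V)) : Set V :=
  ⋃ s ∈ T, convexHull ℝ (s : Set V)

end Complexes

/-! ### Delaunay complexes on the sphere and their subdivisions -/

section Delaunay

variable {d : ℕ}

/-- The geodesic distance of `S^d`, in terms of the Euclidean distance. -/
def geoDist (x y : Amb d) : ℝ := 2 * Real.arcsin (‖x - y‖ / 2)

/-- The empty circle property: `s` lies on a geodesic sphere of `S^d` whose open ball contains no
point of `X`. -/
def EmptyCircle (X : Set (Amb d)) (s : Finset (Amb d)) : Prop :=
  ∃ c ∈ Sph d, ∃ r : ℝ, (∀ v ∈ s, geoDist c v = r) ∧ ∀ x ∈ X, r ≤ geoDist c x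

/-- The Delaunay complex `Del(X)` of `X ⊂ S^d`: its maximal simplices are the subsets of `d + 1`
points of `X` that have the empty circle property. -/
def delaunay (X : Set (Amb d)) : PreAbstractSimplicialComplex (Amb d) where
  faces := {s | s.Nonempty ∧
    ∃ t : Finset (Amb d), (t : Set (Amb d)) ⊆ X ∧ t.card = d + 1 ∧ EmptyCircle X t ∧ s ⊆ t}
  isRelLowerSet_faces := by
    rintro s ⟨hs, t, htX, htc, hte, hst⟩
    exact ⟨hs, fun u hu hune => ⟨hune, t, htX, htc, hte, hu.trans hst⟩⟩

/-- The radial projection `|K| → S^d`, `x ↦ x / ‖x‖`, is (well-defined and) a homeomorphism.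
Since `normalize 0 = 0` is not in `S^d`, this contains that `0 ∉ |K|`. -/
def RadiallyHomeomorphic (K : PreAbstractSimplicialComplex (Amb d)) : Prop :=
  ∃ h : underlying K.faces ≃ₜ Sph d,
    ∀ x : underlying K.faces, (h x : Amb d) = NormedSpace.normalize (x : Amb d)

/-- The set of Euclidean lengths of the edges of `K`. -/
def edgeLengths (K : PreAbstractSimplicialComplex (Amb d)) : Set ℝ :=
  {t | ∃ u v, IsEdge K u v ∧ t = ‖u - v‖}

/-- The vertices of the barycentric subdivision of `K`: the barycenters of its simplices. -/
def barycentricVertices (K : PreAbstractSimplicialComplex (Amb d)) : Set (Amb d) :=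
  {b | ∃ s ∈ K.faces, b = (s.card : ℝ)⁻¹ • ∑ v ∈ s, v}

/-- The vertices of the edgewise subdivision of `K`: its vertices and the midpoints of its
edges. -/
def edgewiseVertices (K : PreAbstractSimplicialComplex (Amb d)) : Set (Amb d) :=
  vertexSet K ∪ {m | ∃ u v, IsEdge K u v ∧ m = midpoint ℝ u v}

/-- Delaunay barycentric subdivision: the Delaunay complex on the normalized vertices of the
barycentric subdivision. -/
def delaunayBarycentric (K : PreAbstractSimplicialComplex (Amb d)) :
    PreAbstractSimplicialComplex (Amb d) :=
  delaunay (NormedSpace.normalize '' barycentricVertices K)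

/-- Delaunay edgewise subdivision: the Delaunay complex on the normalized vertices of the
edgewise subdivision. -/
def delaunayEdgewise (K : PreAbstractSimplicialComplex (Amb d)) :
    PreAbstractSimplicialComplex (Amb d) :=
  delaunay (NormedSpace.normalize '' edgewiseVertices K)

/-- `ℓ(δ) = 1 - √(1 - (1/2) (d/(d+1)) δ²)`. -/
def ell (d : ℕ) (δ : ℝ) : ℝ :=
  1 - √(1 - 1 / 2 * ((d : ℝ) / (d + 1)) * δ ^ 2)

end Delaunay

/-! ### Star conditions and the algorithm -/

section Algorithm

variable {d n : ℕ}

/-- The radial projection `ℝ^(d+1) \ {0} → S^d`. -/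
def radial (x : {x : Amb d // x ≠ 0}) : Sph d :=
  ⟨NormedSpace.normalize x.1, by simpa using x.2⟩

variable {L : Geometry.SimplicialComplex ℝ (EuclideanSpace ℝ (Fin n))}

/-- For a map `F : S^d → |L|` and a complex `K` with `|K| ⊂ ℝ^(d+1)`, the composition
`f : |K| → S^d → |L|` of `F` with the radial projection is defined at all points of `A ⊆ |K|`, and
`f(A) ⊆ B`. -/
def MapsRadially (F : C(Sph d, L.space)) (A : Set (Amb d)) (B : Set (EuclideanSpace ℝ (Fin n))) :
    Prop :=
  ∀ x ∈ A, ∃ hx : x ≠ 0, (F (radial ⟨x, hx⟩) : EuclideanSpace ℝ (Fin n)) ∈ B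

/-- The star condition for `f : |K| → |L|`: for every vertex `v` of `K` there is a vertex `w` of
`L` with `f(|closed star of v|) ⊆ |open star of w|`. -/
def StarCondition (F : C(Sph d, L.space)) (K : PreAbstractSimplicialComplex (Amb d)) : Prop :=
  ∀ v ∈ vertexSet K, ∃ w ∈ L.vertices,
    MapsRadially F (underlying (closedStar K v)) (openStarSpace L.toPreAbstractSimplicialComplex w)

/-- The vertices of the closed star of `v`: the neighbours of `v`, with `v` included. -/
def closedStarVertices (K : PreAbstractSimplicialComplex (Amb d)) (v : Amb d) : Set (Amb d) :=
  {u | {u} ∈ closedStar K v}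

/-- The weak star condition for `f : |K| → |L|`: for every vertex `v` of `K` there is a vertex `w`
of `L` with `f(vertices of the closed star of v) ⊆ |open star of w|`. -/
def WeakStarCondition (F : C(Sph d, L.space)) (K : PreAbstractSimplicialComplex (Amb d)) : Prop :=
  ∀ v ∈ vertexSet K, ∃ w ∈ L.vertices,
    MapsRadially F (closedStarVertices K v) (openStarSpace L.toPreAbstractSimplicialComplex w)

/-- `g` is a weak simplicial approximation to `f : |K| → |L|`. -/
def IsWeakSimplicialApprox (F : C(Sph d, L.space)) (K : PreAbstractSimplicialComplex (Amb d))
    (g : vertexSet K → L.vertices) : Prop :=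
  ∀ v : vertexSet K,
    MapsRadially F (closedStarVertices K v) (openStarSpace L.toPreAbstractSimplicialComplex (g v))

/-- Execution of the loop `while not exitTest do s := step s`: `WhileLoop exitTest step s t` means that the
loop started in the state `s` ends, after finitely many iterations, in the state `t`. -/
inductive WhileLoop {S : Type*} (exitTest : S → Prop) (step : S → S) : S → S → Prop
  | exit {s : S} : exitTest s → WhileLoop exitTest step s s
  | iterate {s t : S} : ¬ exitTest s → WhileLoop exitTest step (step s) t → WhileLoop exitTest step s t

/-- The algorithm that starts from `K`, replaces the current complex by its (normalized)
subdivision `subdiv` until the test `exitTest` succeeds, and then returns a weak simplicial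
approximation to `f` on the final complex, terminates. -/
def AlgorithmTerminates (F : C(Sph d, L.space))
    (exitTest : PreAbstractSimplicialComplex (Amb d) → Prop)
    (subdiv : PreAbstractSimplicialComplex (Amb d) → PreAbstractSimplicialComplex (Amb d))
    (K : PreAbstractSimplicialComplex (Amb d)) : Prop :=
  ∃ K' : PreAbstractSimplicialComplex (Amb d), WhileLoop exitTest subdiv K K' ∧
    ∃ g : vertexSet K' → L.vertices, IsWeakSimplicialApprox F K' g

end Algorithm

end SphericalDelaunay

end

/-! The star condition holds once the edges are short enough: `|L|` is covered by the complements of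
the closed unions of simplices avoiding a given vertex, and each complement lies, within `|L|`, in
an open star. Lebesgue's lemma on the compact sphere then gives the scale
(`exists_lebesgue_number`). It remains to see that subdivision shortens edges by a fixed factor.

A subdivision need not again project homeomorphically, so the invariant carried along is the weaker
`IsMesh`: the top-dimensional simplices cover the sphere radially and edges have length at most `δ`.
Put `q = d / (d + 1)`. By a variance estimate, simplices stay at distance at least `m = √(1 - q δ² /
2)` from the origin, where radial projection is `1 / m`-Lipschitz. If the new vertices are `ρ`-dense
in the old simplices, their projections are thus `ρ / m`-dense in the sphere. An empty cap then has
chordal radius at most `ρ / m`, so the new edges are at most `2 ρ / m` (`norm_sub_le_of_dense`).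
Covering persists because Delaunay simplices lie on the boundary of the convex hull of the points,
which surrounds the origin (`radiallyCovers_of_dense`). All this is `IsMesh.refine`.

Jung's inequality in the simplices of the Euclidean subdivision gives `2 ρ = κ δ`, with `κ = √2
q^(3/2)` for barycenters and `κ = √(q / 2)` for midpoints. The hypotheses on `d` and `δ` say enough
to get `κ < m`, and the same `m` serves all later, finer meshes. -/

noncomputable section

namespace SphericalDelaunay

/-! ### Variance, Jung's inequality and radial projection. -/

section Variance

variable {ι E : Type*} [NormedAddCommGroup E] [InnerProductSpace ℝ E]

/-- The variance of a finitely supported probability measure, in terms of pairwise distances. -/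
theorem sum_mul_norm_sq_sub_norm_sum_sq (t : Finset ι) (w : ι → ℝ) (y : ι → E)
    (hw : ∑ i ∈ t, w i = 1) :
    ∑ i ∈ t, w i * ‖y i‖ ^ 2 - ‖∑ i ∈ t, w i • y i‖ ^ 2 =
      1 / 2 * ∑ i ∈ t, ∑ j ∈ t, w i * w j * ‖y i - y j‖ ^ 2 := by
  have h1 : ‖∑ i ∈ t, w i • y i‖ ^ 2 = ∑ i ∈ t, ∑ j ∈ t, w i * w j * inner ℝ (y i) (y j) := by
    rw [← real_inner_self_eq_norm_sq, sum_inner]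
    refine Finset.sum_congr rfl fun i _ => ?_
    rw [inner_sum]
    refine Finset.sum_congr rfl fun j _ => ?_
    rw [real_inner_smul_left, real_inner_smul_right]; ring
  have h2 : ∑ i ∈ t, ∑ j ∈ t, w i * w j * ‖y i - y j‖ ^ 2 =
      ∑ i ∈ t, ∑ j ∈ t, (w i * ‖y i‖ ^ 2 * w j + w i * (w j * ‖y j‖ ^ 2)
        - 2 * (w i * w j * inner ℝ (y i) (y j))) := by
    refine Finset.sum_congr rfl fun i _ => Finset.sum_congr rfl fun j _ => ?_
    rw [norm_sub_sq_real]; ring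
  rw [h2, h1]
  simp only [Finset.sum_add_distrib, Finset.sum_sub_distrib, ← Finset.mul_sum, ← Finset.sum_mul, hw]
  ring

theorem sum_mul_norm_sq_sub_norm_sum_sq_le (t : Finset ι) (w : ι → ℝ) (y : ι → E) {D : ℝ} {N : ℕ}
    (hN : t.card ≤ N) (hw0 : ∀ i ∈ t, 0 ≤ w i) (hw : ∑ i ∈ t, w i = 1)
    (hD : ∀ i ∈ t, ∀ j ∈ t, ‖y i - y j‖ ≤ D) :
    ∑ i ∈ t, w i * ‖y i‖ ^ 2 - ‖∑ i ∈ t, w i • y i‖ ^ 2 ≤ 1 / 2 * (1 - 1 / (N : ℝ)) * D ^ 2 := by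
  classical
  rw [sum_mul_norm_sq_sub_norm_sum_sq t w y hw]
  have hcard : 0 < t.card := by
    rw [Finset.card_pos]
    by_contra h
    simp [Finset.not_nonempty_iff_eq_empty.1 h] at hw
  have hNpos : (0 : ℝ) < N := by exact_mod_cast hcard.trans_le hN
  have h1 : ∀ i ∈ t, ∀ j ∈ t, w i * w j * ‖y i - y j‖ ^ 2 ≤
      w i * w j * D ^ 2 - if i = j then w i * w j * D ^ 2 else 0 := by
    intro i hi j hj
    split_ifs with h
    · simp [h]
    · rw [sub_zero]
      exact mul_le_mul_of_nonneg_left (pow_le_pow_left₀ (norm_nonneg _) (hD i hi j hj) 2)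
        (mul_nonneg (hw0 i hi) (hw0 j hj))
  -- The diagonal terms vanish; the off-diagonal weights add up to `1 - ∑ w i ^ 2`, which
  -- Cauchy-Schwarz bounds by `1 - 1 / N`.
  have h2 : ∑ i ∈ t, ∑ j ∈ t, w i * w j * ‖y i - y j‖ ^ 2 ≤ (1 - ∑ i ∈ t, w i ^ 2) * D ^ 2 := by
    refine (Finset.sum_le_sum fun i hi => Finset.sum_le_sum fun j hj => h1 i hi j hj).trans
      (le_of_eq ?_)
    simp only [Finset.sum_sub_distrib, ← Finset.mul_sum, ← Finset.sum_mul, hw, Finset.sum_ite_eq]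
    rw [Finset.sum_congr rfl (g := fun i => w i ^ 2 * D ^ 2)
      (fun i hi => by rw [if_pos hi]; ring), ← Finset.sum_mul]
    ring
  have h3 : 1 / (N : ℝ) ≤ ∑ i ∈ t, w i ^ 2 := by
    have h := sq_sum_le_card_mul_sum_sq (s := t) (f := w)
    rw [hw] at h
    have hs : 0 ≤ ∑ i ∈ t, w i ^ 2 := Finset.sum_nonneg fun i _ => sq_nonneg _
    rw [div_le_iff₀ hNpos]
    have : (t.card : ℝ) ≤ N := by exact_mod_cast hN
    nlinarith
  nlinarith [sq_nonneg D]

/-- A version of Jung's inequality: a point in the convex hull of `N` points at mutual distances at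
most `D` is close to one of them. -/
theorem exists_norm_sub_sq_le (t : Finset ι) (w : ι → ℝ) (y : ι → E) {D : ℝ} {N : ℕ}
    (hN : t.card ≤ N) (hw0 : ∀ i ∈ t, 0 ≤ w i) (hw : ∑ i ∈ t, w i = 1)
    (hD : ∀ i ∈ t, ∀ j ∈ t, ‖y i - y j‖ ≤ D) :
    ∃ i ∈ t, ‖∑ j ∈ t, w j • y j - y i‖ ^ 2 ≤ 1 / 2 * (1 - 1 / (N : ℝ)) * D ^ 2 := by
  have key := sum_mul_norm_sq_sub_norm_sum_sq_le t w y hN hw0 hw hD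
  set x := ∑ j ∈ t, w j • y j with hx
  by_contra! hcon
  -- The variance is the mean squared distance to `x`, so not all these distances can exceed its
  -- bound.
  have h1 : ∑ i ∈ t, w i * ‖x - y i‖ ^ 2 = ∑ i ∈ t, w i * ‖y i‖ ^ 2 - ‖x‖ ^ 2 := by
    have h : ∀ i ∈ t, w i * ‖x - y i‖ ^ 2 =
        w i * ‖x‖ ^ 2 - 2 * inner ℝ x (w i • y i) + w i * ‖y i‖ ^ 2 := by
      intro i _
      rw [norm_sub_sq_real, real_inner_smul_right]; ring
    rw [Finset.sum_congr rfl h, Finset.sum_add_distrib, Finset.sum_sub_distrib, ← Finset.sum_mul,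
      ← Finset.mul_sum, ← inner_sum, hw, ← hx, real_inner_self_eq_norm_sq]
    ring
  have h2 : 1 / 2 * (1 - 1 / (N : ℝ)) * D ^ 2 < ∑ i ∈ t, w i * ‖x - y i‖ ^ 2 := by
    have h3 : 1 / 2 * (1 - 1 / (N : ℝ)) * D ^ 2 =
        ∑ i ∈ t, w i * (1 / 2 * (1 - 1 / (N : ℝ)) * D ^ 2) := by
      rw [← Finset.sum_mul, hw, one_mul]
    rw [h3]
    obtain ⟨i, hi, hwi⟩ : ∃ i ∈ t, 0 < w i := by
      by_contra! h
      have := Finset.sum_nonpos h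
      linarith
    exact Finset.sum_lt_sum
      (fun i hi => mul_le_mul_of_nonneg_left (hcon i hi).le (hw0 i hi))
      ⟨i, hi, mul_lt_mul_of_pos_left (hcon i hi) hwi⟩
  linarith

/-- Points of a simplex inscribed in the unit sphere are far from the origin. -/
theorem le_norm_sq_of_mem_convexHull {t : Finset E} {x : E} {D : ℝ} {N : ℕ} (hN : t.card ≤ N)
    (ht : ∀ v ∈ t, ‖v‖ = 1) (hD : ∀ u ∈ t, ∀ v ∈ t, ‖u - v‖ ≤ D)
    (hx : x ∈ convexHull ℝ (t : Set E)) :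
    1 - 1 / 2 * (1 - 1 / (N : ℝ)) * D ^ 2 ≤ ‖x‖ ^ 2 := by
  obtain ⟨w, hw0, hw, rfl⟩ := Finset.mem_convexHull'.1 hx
  have h := sum_mul_norm_sq_sub_norm_sum_sq_le t w id hN hw0 hw hD
  rw [Finset.sum_congr rfl (g := w) (fun i hi => by simp [ht i hi]), hw] at h
  simp only [id] at h
  linarith

/-- With `p`, `q` the normalizations, `‖x - y‖² = (‖x‖ - ‖y‖)² + ‖x‖ ‖y‖ ‖p - q‖²`, and `‖x‖ ‖y‖ ≥
m²`. -/
theorem norm_normalize_sub_normalize_le {x y : E} {m : ℝ} (hm : 0 < m) (hx : m ≤ ‖x‖)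
    (hy : m ≤ ‖y‖) :
    ‖NormedSpace.normalize x - NormedSpace.normalize y‖ ≤ ‖x - y‖ / m := by
  have hx0 : 0 < ‖x‖ := hm.trans_le hx
  have hy0 : 0 < ‖y‖ := hm.trans_le hy
  have hp : ‖NormedSpace.normalize x‖ = 1 :=
    NormedSpace.norm_normalize_eq_one_iff.2 (norm_pos_iff.1 hx0)
  have hq : ‖NormedSpace.normalize y‖ = 1 :=
    NormedSpace.norm_normalize_eq_one_iff.2 (norm_pos_iff.1 hy0)
  have hi : inner ℝ x y = ‖x‖ * ‖y‖ * inner ℝ (NormedSpace.normalize x) (NormedSpace.normalize y) := by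
    conv_lhs => rw [← NormedSpace.norm_smul_normalize x, ← NormedSpace.norm_smul_normalize y]
    rw [real_inner_smul_left, real_inner_smul_right]; ring
  rw [le_div_iff₀ hm]
  refine (sq_le_sq₀ (by positivity) (norm_nonneg _)).1 ?_
  rw [mul_pow, norm_sub_sq_real, norm_sub_sq_real x y, hp, hq, hi]
  have hle : inner ℝ (NormedSpace.normalize x) (NormedSpace.normalize y) ≤ 1 := by
    simpa [hp, hq] using real_inner_le_norm (NormedSpace.normalize x) (NormedSpace.normalize y)
  have hmm : m ^ 2 ≤ ‖x‖ * ‖y‖ := by nlinarith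
  nlinarith [sq_nonneg (‖x‖ - ‖y‖), mul_nonneg (sub_nonneg.2 hmm) (sub_nonneg.2 hle)]

end Variance

/-! ### Density of barycenters and midpoints in a simplex. -/

section Covering

variable {E : Type*} [NormedAddCommGroup E] [InnerProductSpace ℝ E]

/-- The barycenter of a finite set of points. -/
def barycenter (s : Finset E) : E := (s.card : ℝ)⁻¹ • ∑ v ∈ s, v

/-- A nonnegative combination of points is a nonnegative combination of the barycenters of a flag. -/
theorem exists_flag_barycenters (s : Finset E) : ∀ c : E → ℝ, (∀ v ∈ s, 0 < c v) →
    ∃ (C : Finset (Finset E)) (w : Finset E → ℝ), C.card ≤ s.card ∧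
      (∀ S ∈ C, S.Nonempty ∧ S ⊆ s) ∧ (∀ S ∈ C, ∀ T ∈ C, S ⊆ T ∨ T ⊆ S) ∧
      (∀ S ∈ C, 0 ≤ w S) ∧ ∑ S ∈ C, w S = ∑ v ∈ s, c v ∧
      ∑ S ∈ C, w S • barycenter S = ∑ v ∈ s, c v • v := by
  classical
  induction s using Finset.strongInduction with
  | H s ih =>
    intro c hc
    rcases s.eq_empty_or_nonempty with rfl | hs
    · exact ⟨∅, 0, by simp, by simp, by simp, by simp, by simp, by simp⟩
    obtain ⟨v₀, hv₀, hmin⟩ := s.exists_min_image c hs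
    -- Subtracting the least coefficient everywhere splits off `m * s.card` times the barycenter of
    -- `s`; what remains is supported on a strictly smaller set, to which induction applies.
    set m := c v₀ with hm
    set s' := s.filter (fun v => m < c v) with hs'
    have hsub : s' ⊂ s := by
      refine Finset.filter_ssubset.2 ⟨v₀, hv₀, by simp [hm]⟩
    obtain ⟨C, w, h1, h2, h3, h4, h5, h6⟩ := ih s' hsub (fun v => c v - m) (by
      intro v hv
      exact sub_pos.2 (Finset.mem_filter.1 hv).2)
    have hsC : s ∉ C := fun h => hsub.not_subset (h2 s h).2
    have hcard : (s.card : ℝ) ≠ 0 := by exact_mod_cast hs.card_pos.ne'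
    have hw : ∀ S ∈ C, Function.update w s (m * s.card) S = w S := fun S hS =>
      Function.update_of_ne (ne_of_mem_of_not_mem hS hsC) _ _
    have hout : ∀ v ∈ s, v ∉ s' → c v - m = 0 := by
      intro v hv hv'
      have : ¬ m < c v := fun h => hv' (Finset.mem_filter.2 ⟨hv, h⟩)
      linarith [hmin v hv]
    refine ⟨insert s C, Function.update w s (m * s.card), ?_, ?_, ?_, ?_, ?_, ?_⟩
    · rw [Finset.card_insert_of_notMem hsC]
      have := Finset.card_lt_card hsub
      omega
    · intro S hS
      rcases Finset.mem_insert.1 hS with rfl | hS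
      · exact ⟨hs, subset_rfl⟩
      · exact ⟨(h2 S hS).1, (h2 S hS).2.trans hsub.subset⟩
    · have hle : ∀ S ∈ insert s C, S ⊆ s := fun S hS => (Finset.mem_insert.1 hS).elim
        (fun h => h.subset) (fun h => (h2 S h).2.trans hsub.subset)
      intro S hS T hT
      rcases Finset.mem_insert.1 hS with rfl | hS'
      · exact Or.inr (hle T hT)
      · rcases Finset.mem_insert.1 hT with rfl | hT'
        · exact Or.inl (hle S hS)
        · exact h3 S hS' T hT'
    · intro S hS
      rcases Finset.mem_insert.1 hS with rfl | hS
      · rw [Function.update_self]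
        exact mul_nonneg (hc v₀ hv₀).le (Nat.cast_nonneg _)
      · rw [hw S hS]; exact h4 S hS
    · rw [Finset.sum_insert hsC, Function.update_self, Finset.sum_congr rfl hw, h5,
        Finset.sum_subset hsub.subset hout, Finset.sum_sub_distrib, Finset.sum_const, nsmul_eq_mul]
      ring
    · rw [Finset.sum_insert hsC, Function.update_self,
        Finset.sum_congr rfl (fun S hS => by rw [hw S hS]), h6,
        Finset.sum_subset hsub.subset (fun v hv hv' => by rw [hout v hv hv', zero_smul]),
        barycenter, smul_smul, mul_assoc, mul_inv_cancel₀ hcard, mul_one, Finset.smul_sum,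
        ← Finset.sum_add_distrib]
      exact Finset.sum_congr rfl fun v _ => by rw [← add_smul]; simp

/-- `u - barycenter T` is the average of the `u - v`, and the term `v = u` is zero. -/
theorem norm_sub_barycenter_le {T : Finset E} {δ : ℝ} {N : ℕ} (hN : T.card ≤ N) (hδ : 0 ≤ δ)
    (hT : ∀ u ∈ T, ∀ v ∈ T, ‖u - v‖ ≤ δ) {u : E} (hu : u ∈ T) :
    ‖u - barycenter T‖ ≤ (1 - 1 / (N : ℝ)) * δ := by
  classical
  have hpos : (0 : ℝ) < T.card := by exact_mod_cast Finset.card_pos.2 ⟨u, hu⟩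
  have h1 : u - barycenter T = (T.card : ℝ)⁻¹ • ∑ v ∈ T, (u - v) := by
    rw [barycenter, Finset.sum_sub_distrib, smul_sub, Finset.sum_const, ← Nat.cast_smul_eq_nsmul ℝ,
      smul_smul, inv_mul_cancel₀ hpos.ne', one_smul]
  have h2 : ‖∑ v ∈ T, (u - v)‖ ≤ (T.card - 1) * δ := by
    rw [← Finset.add_sum_erase T _ hu, sub_self, zero_add]
    refine (norm_sum_le_of_le _ (fun v hv => hT u hu v (Finset.mem_of_mem_erase hv))).trans ?_
    rw [Finset.sum_const, Finset.card_erase_of_mem hu, nsmul_eq_mul,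
      Nat.cast_pred (Finset.card_pos.2 ⟨u, hu⟩)]
  rw [h1, norm_smul, norm_inv, Real.norm_natCast, inv_mul_le_iff₀ hpos]
  have h3 : 1 / (N : ℝ) ≤ 1 / T.card := one_div_le_one_div_of_le hpos (by exact_mod_cast hN)
  calc _ ≤ ((T.card : ℝ) - 1) * δ := h2
    _ = T.card * ((1 - 1 / (T.card : ℝ)) * δ) := by field_simp
    _ ≤ _ := by gcongr

theorem norm_barycenter_sub_barycenter_le {S T : Finset E} {δ : ℝ} {N : ℕ} (hN : T.card ≤ N)
    (hδ : 0 ≤ δ) (hT : ∀ u ∈ T, ∀ v ∈ T, ‖u - v‖ ≤ δ) (hS : S.Nonempty) (hST : S ⊆ T) :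
    ‖barycenter S - barycenter T‖ ≤ (1 - 1 / (N : ℝ)) * δ := by
  have hpos : (0 : ℝ) < S.card := by exact_mod_cast hS.card_pos
  have h1 : barycenter S - barycenter T = (S.card : ℝ)⁻¹ • ∑ u ∈ S, (u - barycenter T) := by
    rw [Finset.sum_sub_distrib, smul_sub, Finset.sum_const, ← Nat.cast_smul_eq_nsmul ℝ,
      smul_smul, inv_mul_cancel₀ hpos.ne', one_smul, ← barycenter]
  rw [h1, norm_smul, norm_inv, Real.norm_natCast, inv_mul_le_iff₀ hpos]
  refine (norm_sum_le_of_le _ fun u hu => norm_sub_barycenter_le hN hδ hT (hST hu)).trans ?_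
  rw [Finset.sum_const, nsmul_eq_mul]

/-- Every point of a simplex is close to the barycenter of some face. -/
theorem exists_barycenter_near {t : Finset E} {δ : ℝ} {N : ℕ} (hN : t.card ≤ N) (hδ : 0 ≤ δ)
    (ht : ∀ u ∈ t, ∀ v ∈ t, ‖u - v‖ ≤ δ) {x : E} (hx : x ∈ convexHull ℝ (t : Set E)) :
    ∃ S ⊆ t, S.Nonempty ∧
      ‖x - barycenter S‖ ^ 2 ≤ 1 / 2 * (1 - 1 / (N : ℝ)) * ((1 - 1 / (N : ℝ)) * δ) ^ 2 := by
  classical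
  obtain ⟨c, hc0, hc, rfl⟩ := Finset.mem_convexHull'.1 hx
  -- Flags require positive coefficients. Jung's inequality is then applied to the barycenters of
  -- the flag, whose diameter is at most `(1 - 1 / N) * δ`.
  set s := t.filter (fun v => 0 < c v) with hs
  have hout : ∀ v ∈ t, v ∉ s → c v = 0 := by
    intro v hv hv'
    have : ¬ 0 < c v := fun h => hv' (Finset.mem_filter.2 ⟨hv, h⟩)
    linarith [hc0 v hv]
  have hst : s ⊆ t := Finset.filter_subset _ _
  obtain ⟨C, w, h1, h2, h3, h4, h5, h6⟩ :=
    exists_flag_barycenters s c (fun v hv => (Finset.mem_filter.1 hv).2)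
  rw [Finset.sum_subset hst hout, hc] at h5
  rw [Finset.sum_subset hst (fun v hv hv' => by rw [hout v hv hv', zero_smul])] at h6
  have hcard : ∀ S ∈ C, S.card ≤ N := fun S hS =>
    (Finset.card_le_card ((h2 S hS).2.trans hst)).trans hN
  have hdist : ∀ S ∈ C, ∀ u ∈ S, ∀ v ∈ S, ‖u - v‖ ≤ δ := fun S hS u hu v hv =>
    ht u (hst ((h2 S hS).2 hu)) v (hst ((h2 S hS).2 hv))
  obtain ⟨S, hS, hle⟩ := exists_norm_sub_sq_le C w barycenter
    (h1.trans ((Finset.card_le_card hst).trans hN)) h4 h5 (D := (1 - 1 / (N : ℝ)) * δ) (by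
      intro S hS T hT
      rcases h3 S hS T hT with h | h
      · exact norm_barycenter_sub_barycenter_le (hcard T hT) hδ (hdist T hT) (h2 S hS).1 h
      · rw [norm_sub_rev]
        exact norm_barycenter_sub_barycenter_le (hcard S hS) hδ (hdist S hS) (h2 T hT).1 h)
  exact ⟨S, (h2 S hS).2.trans hst, (h2 S hS).1, by rwa [h6] at hle⟩

/-- Every point of a simplex of dimension at most `2` is close to a vertex or to the midpoint of an
edge. -/
theorem exists_midpoint_near {t : Finset E} {δ : ℝ} {N : ℕ} (hN : t.card ≤ N) (hN3 : N ≤ 3)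
    (ht : ∀ u ∈ t, ∀ v ∈ t, ‖u - v‖ ≤ δ) {x : E} (hx : x ∈ convexHull ℝ (t : Set E)) :
    ∃ u ∈ t, ∃ v ∈ t, ‖x - midpoint ℝ u v‖ ^ 2 ≤ 1 / 2 * (1 - 1 / (N : ℝ)) * (δ / 2) ^ 2 := by
  classical
  obtain ⟨c, hc0, hc, rfl⟩ := Finset.mem_convexHull'.1 hx
  have hhalf : ∀ a b : E, ‖a - b‖ ≤ δ → ‖(2 : ℝ)⁻¹ • (a - b)‖ ≤ δ / 2 := by
    intro a b h
    rw [norm_smul, norm_inv, Real.norm_ofNat]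
    linarith
  -- Either the point lies in the half-size copy of the simplex at the corner `u`, or all
  -- coordinates are below `1 / 2`; then `t` is a triangle and the point lies in its medial
  -- triangle.
  by_cases hbig : ∃ u ∈ t, 1 / 2 ≤ c u
  · obtain ⟨u, hu, hcu⟩ := hbig
    obtain ⟨v, hv, hle⟩ := exists_norm_sub_sq_le t (fun v => 2 * c v - if v = u then 1 else 0)
      (fun v => midpoint ℝ u v) hN (D := δ / 2)
      (by
        intro v hv
        split_ifs with h
        · subst h; linarith
        · linarith [hc0 v hv])
      (by rw [Finset.sum_sub_distrib, ← Finset.mul_sum, hc, Finset.sum_ite_eq', if_pos hu]; norm_num)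
      (by
        intro v hv v' hv'
        have : midpoint ℝ u v - midpoint ℝ u v' = (2 : ℝ)⁻¹ • (v - v') := by
          simp only [midpoint_eq_smul_add, invOf_eq_inv]; module
        rw [this]
        exact hhalf v v' (ht v hv v' hv'))
    have hsum : ∑ v ∈ t, (2 * c v - if v = u then 1 else 0) • midpoint ℝ u v =
        ∑ v ∈ t, c v • v := by
      have h : ∀ v ∈ t, (2 * c v - if v = u then (1 : ℝ) else 0) • midpoint ℝ u v =
          c v • u + c v • v - if v = u then u else 0 := by
        intro v _
        simp only [midpoint_eq_smul_add, invOf_eq_inv]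
        split_ifs with h
        · subst h; module
        · module
      rw [Finset.sum_congr rfl h, Finset.sum_sub_distrib, Finset.sum_add_distrib,
        ← Finset.sum_smul, hc, Finset.sum_ite_eq', if_pos hu]
      module
    exact ⟨u, hu, v, hv, by rwa [hsum] at hle⟩
  · push Not at hbig
    have htne : t.Nonempty := by
      rw [Finset.nonempty_iff_ne_empty]
      rintro rfl
      simp at hc
    have hcard : t.card = 3 := by
      have h1 : ∑ v ∈ t, c v < ∑ v ∈ t, (1 / 2 : ℝ) := Finset.sum_lt_sum_of_nonempty htne hbig
      rw [hc, Finset.sum_const, nsmul_eq_mul] at h1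
      have h2 : (2 : ℝ) < t.card := by linarith
      have h3 : 2 < t.card := by exact_mod_cast h2
      omega
    -- For a triangle, `(∑ u - v) / 2` is the midpoint of the edge opposite `v`.
    obtain ⟨v, hv, hle⟩ := exists_norm_sub_sq_le t (fun v => 1 - 2 * c v)
      (fun v => (2 : ℝ)⁻¹ • (∑ u ∈ t, u - v)) hN (D := δ / 2)
      (fun v hv => by linarith [hbig v hv])
      (by rw [Finset.sum_sub_distrib, ← Finset.mul_sum, hc, Finset.sum_const, hcard]; norm_num)
      (by
        intro v hv v' hv'
        have : (2 : ℝ)⁻¹ • (∑ u ∈ t, u - v) - (2 : ℝ)⁻¹ • (∑ u ∈ t, u - v') =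
            (2 : ℝ)⁻¹ • (v' - v) := by module
        rw [this]
        exact hhalf v' v (ht v' hv' v hv))
    have hsum : ∑ v ∈ t, (1 - 2 * c v) • (2 : ℝ)⁻¹ • (∑ u ∈ t, u - v) = ∑ v ∈ t, c v • v := by
      have h : ∀ v ∈ t, (1 - 2 * c v) • (2 : ℝ)⁻¹ • (∑ u ∈ t, u - v) =
          (2 : ℝ)⁻¹ • ∑ u ∈ t, u - c v • ∑ u ∈ t, u - (2 : ℝ)⁻¹ • v + c v • v := by
        intro v _
        module
      rw [Finset.sum_congr rfl h, Finset.sum_add_distrib, Finset.sum_sub_distrib,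
        Finset.sum_sub_distrib, ← Finset.sum_smul, Finset.sum_const, ← Finset.sum_smul, hc, hcard, ← Finset.smul_sum]
      module
    rw [hsum] at hle
    obtain ⟨a, b, -, hab⟩ := Finset.card_eq_two.1
      (show (t.erase v).card = 2 by rw [Finset.card_erase_of_mem hv, hcard])
    have ha : a ∈ t := Finset.mem_of_mem_erase (hab ▸ Finset.mem_insert_self a {b})
    have hb : b ∈ t := Finset.mem_of_mem_erase (a := v) (hab ▸ by simp)
    refine ⟨a, ha, b, hb, ?_⟩
    have hmid : (2 : ℝ)⁻¹ • (∑ u ∈ t, u - v) = midpoint ℝ a b := by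
      have hne : a ≠ b := by
        rintro rfl
        have := congrArg Finset.card hab
        rw [Finset.card_erase_of_mem hv, hcard] at this
        simp at this
      rw [← Finset.add_sum_erase t _ hv, hab, Finset.sum_pair hne, midpoint_eq_smul_add,
        invOf_eq_inv]
      module
    rwa [hmid] at hle

end Covering

/-! ### Supporting hyperplanes of polytopes around the origin. -/

section Polytope

variable {E : Type*} [NormedAddCommGroup E] [InnerProductSpace ℝ E]

/-- A point of a polytope on a supporting hyperplane belongs to the hull of the contact points. -/
theorem mem_convexHull_active {X : Set E} (hX : X.Finite) {c y : E} (hy : y ∈ convexHull ℝ X)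
    (hc : ∀ x ∈ X, inner ℝ c x ≤ 1) (hcy : inner ℝ c y = 1) :
    y ∈ convexHull ℝ {x ∈ X | inner ℝ c x = 1} := by
  classical
  lift X to Finset E using hX
  obtain ⟨w, hw0, hw, rfl⟩ := Finset.mem_convexHull'.1 hy
  -- A mean of values at most `1` equals `1`, so every point off the hyperplane has weight zero.
  have hzero : ∑ x ∈ X, w x * (1 - inner ℝ c x) = 0 := by
    rw [inner_sum] at hcy
    simp only [real_inner_smul_right] at hcy
    simp only [mul_sub, Finset.sum_sub_distrib, mul_one, hw, hcy, sub_self]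
  rw [Finset.sum_eq_zero_iff_of_nonneg
    (fun x hx => mul_nonneg (hw0 x hx) (sub_nonneg.2 (hc x hx)))] at hzero
  have hout : ∀ x ∈ X, w x ≠ 0 → inner ℝ c x = 1 := fun x hx hwx => by
    have := (mul_eq_zero.1 (hzero x hx)).resolve_left hwx
    linarith
  rw [← Finset.sum_filter_of_ne (p := fun x => inner ℝ c x = 1)
    (fun x hx h => hout x hx (fun h0 => h (by rw [h0, zero_smul])))]
  rw [← Finset.sum_filter_of_ne (p := fun x => inner ℝ c x = 1) (fun x hx h => hout x hx h)] at hw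
  refine (convex_convexHull ℝ _).sum_mem (fun x hx => hw0 x (Finset.mem_filter.1 hx).1) hw
    fun x hx => subset_convexHull ℝ _ ?_
  simpa using hx

/-- If a point of a polytope lies on a supporting hyperplane, it lies on one that is spanned by
vertices. -/
theorem exists_support_span_eq_top [FiniteDimensional ℝ E] {X : Set E} (hX : X.Finite) {M : ℝ}
    (hM : ∀ c : E, (∀ x ∈ X, inner ℝ c x ≤ 1) → ‖c‖ ≤ M) {y c₀ : E} (hy : y ∈ convexHull ℝ X)
    (hc₀ : ∀ x ∈ X, inner ℝ c₀ x ≤ 1) (hc₀y : inner ℝ c₀ y = 1) :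
    ∃ c : E, (∀ x ∈ X, inner ℝ c x ≤ 1) ∧ inner ℝ c y = 1 ∧
      Submodule.span ℝ {x ∈ X | inner ℝ c x = 1} = ⊤ := by
  set G : Set E := {c | (∀ x ∈ X, inner ℝ c x ≤ 1) ∧ inner ℝ c y = 1} with hG
  have hclosed : IsClosed G := by
    have h1 : IsClosed {c : E | ∀ x ∈ X, inner ℝ c x ≤ 1} := by
      simp only [Set.ofPred_forall]
      exact isClosed_biInter fun x _ => isClosed_le (by fun_prop) continuous_const
    exact h1.inter (isClosed_eq (by fun_prop) continuous_const)
  have hcomp : IsCompact G := Metric.isCompact_of_isClosed_isBounded hclosed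
    (isBounded_iff_forall_norm_le.2 ⟨M, fun c hc => hM c hc.1⟩)
  -- `G` is a compact face of the polar body. At an extreme point `c` the contact points span: a
  -- nonzero `e` orthogonal to all of them would keep `c ± η • e` in `G` for small `η`.
  obtain ⟨c, hc⟩ := hcomp.extremePoints_nonempty ⟨c₀, hc₀, hc₀y⟩
  obtain ⟨⟨hcX, hcy⟩, hext⟩ := mem_extremePoints.1 hc
  refine ⟨c, hcX, hcy, ?_⟩
  by_contra hne
  set A := {x ∈ X | inner ℝ c x = 1} with hA
  obtain ⟨e, he, he0⟩ := (Submodule.ne_bot_iff _).1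
    (fun h => hne ((Submodule.orthogonal_eq_bot_iff).1 h))
  have heA : ∀ x ∈ Submodule.span ℝ A, inner ℝ e x = 0 := fun x hx =>
    (Submodule.mem_orthogonal' _ _).1 he x hx
  have hey : inner ℝ e y = 0 := heA y
    (convexHull_min Submodule.subset_span (Submodule.convex _) (mem_convexHull_active hX hy hcX hcy))
  have hev : ∀ x ∈ X, ∀ᶠ η in nhdsWithin (0 : ℝ) (Set.Ioi 0),
      inner ℝ c x + η * |inner ℝ e x| ≤ 1 := by
    intro x hx
    by_cases hxA : inner ℝ c x = 1
    · simp [heA x (Submodule.subset_span ⟨hx, hxA⟩), hxA]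
    · have hlt : inner ℝ c x + (0 : ℝ) * |inner ℝ e x| < 1 := by
        simpa using lt_of_le_of_ne (hcX x hx) hxA
      have hcont : Continuous fun η : ℝ => inner ℝ c x + η * |inner ℝ e x| := by fun_prop
      exact ((hcont.continuousAt.eventually_lt continuousAt_const hlt).mono
        fun η h => h.le).filter_mono nhdsWithin_le_nhds
  obtain ⟨η, hη, hη0⟩ := (((Filter.eventually_all_finite hX).2 hev).and self_mem_nhdsWithin).exists
  have hη0 : 0 < η := hη0
  have hmem : ∀ σ : ℝ, |σ| = 1 → c + (σ * η) • e ∈ G := by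
    intro σ hσ
    refine ⟨fun x hx => ?_, ?_⟩
    · rw [inner_add_left, real_inner_smul_left]
      have : σ * η * inner ℝ e x ≤ η * |inner ℝ e x| := by
        calc σ * η * inner ℝ e x ≤ |σ * η * inner ℝ e x| := le_abs_self _
          _ = _ := by rw [abs_mul, abs_mul, hσ, one_mul, abs_of_pos hη0]
      linarith [hη x hx]
    · rw [inner_add_left, real_inner_smul_left, hey, hcy]; ring
  have hc1 := (hext _ (hmem 1 (by simp)) _ (hmem (-1) (by simp))
    ⟨1 / 2, 1 / 2, by norm_num, by norm_num, by norm_num, by module⟩).1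
  simp [hη0.ne', he0] at hc1

/-- A set of unit vectors that meets every closed cap of angular radius `π / 3` contains a ball in
its convex hull. -/
theorem ball_subset_convexHull [CompleteSpace E] {X : Set E} (hX : X.Finite)
    (hne : X.Nonempty) (hdense : ∀ e : E, ‖e‖ = 1 → ∃ x ∈ X, 1 / 2 ≤ inner ℝ e x) :
    Metric.ball (0 : E) (1 / 2) ⊆ convexHull ℝ X := by
  intro z hz
  by_contra hzX
  obtain ⟨f, u, hf, hfz⟩ := geometric_hahn_banach_closed_point (convex_convexHull ℝ X)
    (hX.isClosed_convexHull ℝ) hzX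
  set e := (InnerProductSpace.toDual ℝ E).symm f with he
  have hef : ∀ x, inner ℝ e x = f x := fun x => InnerProductSpace.toDual_symm_apply
  have he0 : e ≠ 0 := by
    rintro h0
    obtain ⟨x, hx⟩ := hne
    have h1 := hf x (subset_convexHull ℝ X hx)
    have h2 := hef x
    have h3 := hef z
    rw [h0, inner_zero_left] at h2 h3
    linarith
  obtain ⟨x, hx, hxe⟩ := hdense (NormedSpace.normalize e)
    (NormedSpace.norm_normalize_eq_one_iff.2 he0)
  have h1 := hf x (subset_convexHull ℝ X hx)
  rw [← hef, ← NormedSpace.norm_smul_normalize e, real_inner_smul_left] at h1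
  have h2 : f z ≤ ‖e‖ * ‖z‖ := by rw [← hef]; exact real_inner_le_norm _ _
  have h3 : ‖z‖ < 1 / 2 := by simpa using hz
  have h4 : 0 < ‖e‖ := norm_pos_iff.2 he0
  nlinarith

/-- Boundedness of the polar body, which makes the extreme point argument of
`exists_support_span_eq_top` available. -/
theorem norm_le_two_of_inner_le_one {X : Set E}
    (hdense : ∀ e : E, ‖e‖ = 1 → ∃ x ∈ X, 1 / 2 ≤ inner ℝ e x) {c : E}
    (hc : ∀ x ∈ X, inner ℝ c x ≤ 1) : ‖c‖ ≤ 2 := by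
  rcases eq_or_ne c 0 with rfl | hc0
  · simp
  obtain ⟨x, hx, hxe⟩ := hdense (NormedSpace.normalize c)
    (NormedSpace.norm_normalize_eq_one_iff.2 hc0)
  have h1 := hc x hx
  rw [← NormedSpace.norm_smul_normalize c, real_inner_smul_left] at h1
  nlinarith [norm_nonneg c]

/-- A ray leaves a convex polytope around the origin through a supporting hyperplane. -/
theorem exists_exit_point [CompleteSpace E] {X : Set E} (hX : X.Finite) {ρ : ℝ} (hρ : 0 < ρ)
    (hball : Metric.ball (0 : E) ρ ⊆ convexHull ℝ X) {p : E} (hp : ‖p‖ = 1) :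
    ∃ τ : ℝ, 0 < τ ∧ τ • p ∈ convexHull ℝ X ∧
      ∃ c : E, (∀ x ∈ X, inner ℝ c x ≤ 1) ∧ inner ℝ c (τ • p) = 1 := by
  set H := convexHull ℝ X with hH
  have hHc : IsCompact H := hX.isCompact_convexHull ℝ
  have hint : (0 : E) ∈ interior H :=
    mem_interior.2 ⟨_, hball, Metric.isOpen_ball, Metric.mem_ball_self hρ⟩
  have hcont : Continuous fun t : ℝ => t • p := by fun_prop
  have hTc : IsCompact ((fun t : ℝ => t • p) ⁻¹' H) := by
    obtain ⟨M, hM⟩ := isBounded_iff_forall_norm_le.1 hHc.isBounded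
    refine Metric.isCompact_of_isClosed_isBounded (hHc.isClosed.preimage hcont)
      (isBounded_iff_forall_norm_le.2 ⟨M, fun t ht => ?_⟩)
    simpa [norm_smul, hp] using hM _ ht
  have hρT : ρ / 2 ∈ (fun t : ℝ => t • p) ⁻¹' H := by
    refine hball ?_
    rw [mem_ball_zero_iff, norm_smul, hp, Real.norm_eq_abs, abs_of_pos (by positivity)]
    linarith
  obtain ⟨τ, hτ, hmax⟩ := hTc.exists_isMaxOn ⟨_, hρT⟩ continuousOn_id
  have hτ0 : 0 < τ := (half_pos hρ).trans_le (hmax hρT)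
  -- By maximality of `τ` the ray cannot be continued inside `H`, so a hyperplane through `τ • p`
  -- supports `H`; it is scaled to height `1`.
  have hnot : τ • p ∉ interior H := by
    intro h
    have hnhds : ∀ᶠ t in nhdsWithin τ (Set.Ioi τ), t • p ∈ interior H :=
      (hcont.continuousAt.eventually (isOpen_interior.mem_nhds h)).filter_mono nhdsWithin_le_nhds
    obtain ⟨t, ht, hlt⟩ := (hnhds.and self_mem_nhdsWithin).exists
    exact absurd (hmax (show t • p ∈ H from interior_subset ht) : t ≤ τ)
      (not_le.2 hlt)
  obtain ⟨f, hf⟩ := geometric_hahn_banach_open_point (convex_convexHull ℝ X).interior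
    isOpen_interior hnot
  have hpos : 0 < f (τ • p) := by simpa using hf 0 hint
  have hle : ∀ x ∈ H, f x ≤ f (τ • p) := by
    intro x hx
    have hcl : x ∈ closure (interior H) := by
      rw [(convex_convexHull ℝ X).closure_interior_eq_closure_of_nonempty_interior ⟨0, hint⟩]
      exact subset_closure hx
    exact le_on_closure (fun a ha => (hf a ha).le) f.continuous.continuousOn continuousOn_const hcl
  refine ⟨τ, hτ0, hτ, (f (τ • p))⁻¹ • (InnerProductSpace.toDual ℝ E).symm f, fun x hx => ?_, ?_⟩
  · rw [real_inner_smul_left, InnerProductSpace.toDual_symm_apply, inv_mul_le_iff₀ hpos, mul_one]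
    exact hle x (subset_convexHull ℝ X hx)
  · rw [real_inner_smul_left, InnerProductSpace.toDual_symm_apply, inv_mul_cancel₀ hpos.ne']

/-- Pairing a linear relation with `c` shows that its coefficients sum to zero, so it is an affine
relation. -/
theorem linearIndependent_of_affineIndependent {s : Set E} {c : E}
    (hs : AffineIndependent ℝ ((↑) : s → E)) (hc : ∀ x ∈ s, inner ℝ c x = 1) :
    LinearIndependent ℝ ((↑) : s → E) := by
  rw [linearIndependent_iff']
  intro t w hw
  refine affineIndependent_iff.1 hs t w ?_ hw
  have h : inner ℝ c (∑ i ∈ t, w i • (i : E)) = ∑ i ∈ t, w i := by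
    rw [inner_sum]
    exact Finset.sum_congr rfl fun i _ => by rw [real_inner_smul_right, hc i i.2, mul_one]
  rw [← h, hw, inner_zero_right]

/-- A point in the hull of a spanning set of points of an affine hyperplane lies in a simplex of
full dimension. -/
theorem exists_basis_mem_convexHull [FiniteDimensional ℝ E] {A : Set E} (hA : A.Finite) {c y : E}
    (hc : ∀ x ∈ A, inner ℝ c x = 1) (hspan : Submodule.span ℝ A = ⊤) (hy : y ∈ convexHull ℝ A) :
    ∃ t : Finset E, (t : Set E) ⊆ A ∧ t.card = Module.finrank ℝ E ∧
      y ∈ convexHull ℝ (t : Set E) := by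
  -- Carathéodory: an affinely independent subset suffices. It is linearly independent and extends
  -- within `A` to a basis.
  rw [convexHull_eq_union] at hy
  simp only [Set.mem_iUnion] at hy
  obtain ⟨s, hsA, hs, hys⟩ := hy
  have hli : LinearIndepOn ℝ id (s : Set E) :=
    linearIndependent_of_affineIndependent hs fun x hx => hc x (hsA hx)
  obtain ⟨b, hbA, hsb, hAb, hb⟩ := exists_linearIndepOn_id_extension hli hsA
  have hbfin := hA.subset hbA
  lift b to Finset E using hbfin
  refine ⟨b, hbA, ?_, convexHull_mono hsb hys⟩
  have htop : Submodule.span ℝ (b : Set E) = ⊤ := by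
    rw [eq_top_iff, ← hspan]
    exact Submodule.span_le.2 hAb
  have h := finrank_span_finset_eq_card (R := ℝ) (s := b) hb
  rw [htop, finrank_top] at h
  exact h.symm

end Polytope

/-! ### Delaunay complexes of dense sets: short edges and covering. -/

section DelaunayCover

variable {d : ℕ}

theorem mem_of_mem_faces_delaunay {X : Set (Amb d)} {s : Finset (Amb d)}
    (hs : s ∈ (delaunay X).faces) {v : Amb d} (hv : v ∈ s) : v ∈ X := by
  obtain ⟨-, t, htX, -, -, hst⟩ := hs
  exact htX (hst hv)

theorem geoDist_le_geoDist_iff {c x y : Amb d} (hc : c ∈ Sph d) (hx : x ∈ Sph d) (hy : y ∈ Sph d) :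
    geoDist c x ≤ geoDist c y ↔ ‖c - x‖ ≤ ‖c - y‖ := by
  have hc' : ‖c‖ = 1 := by simpa using hc
  have hle : ∀ z ∈ Sph d, ‖c - z‖ / 2 ∈ Set.Icc (-1 : ℝ) 1 := by
    intro z hz
    have hz' : ‖z‖ = 1 := by simpa using hz
    have := norm_sub_le c z
    have := norm_nonneg (c - z)
    constructor <;> linarith
  unfold geoDist
  rw [mul_le_mul_iff_right₀ (by norm_num), Real.strictMonoOn_arcsin.le_iff_le (hle x hx) (hle y hy)]
  constructor <;> intro h <;> linarith

/-- The edges of the Delaunay complex of an `ε`-dense set have length at most `2 * ε`. -/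
theorem norm_sub_le_of_dense {X : Set (Amb d)} (hX : X ⊆ Sph d) {ε : ℝ}
    (hdense : ∀ p ∈ Sph d, ∃ x ∈ X, ‖p - x‖ ≤ ε) {s : Finset (Amb d)}
    (hs : s ∈ (delaunay X).faces) {u v : Amb d} (hu : u ∈ s) (hv : v ∈ s) : ‖u - v‖ ≤ 2 * ε := by
  obtain ⟨-, t, htX, -, ⟨c, hc, r, hr, hempty⟩, hst⟩ := hs
  obtain ⟨x, hx, hxε⟩ := hdense c hc
  -- The empty ball cannot reach beyond the point `x` of `X` near its centre.
  have h : ∀ w ∈ s, ‖c - w‖ ≤ ε := fun w hw => by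
    refine le_trans ?_ hxε
    rw [← geoDist_le_geoDist_iff hc (hX (htX (hst hw))) (hX hx), hr w (hst hw)]
    exact hempty x hx
  calc ‖u - v‖ = ‖(c - v) - (c - u)‖ := by congr 1; abel
    _ ≤ ‖c - v‖ + ‖c - u‖ := norm_sub_le _ _
    _ ≤ 2 * ε := by linarith [h u hu, h v hv]

/-- The radial projection from `|K|` covers the sphere. -/
def RadiallyCovers (K : PreAbstractSimplicialComplex (Amb d)) : Prop :=
  ∀ p ∈ Sph d, ∃ s ∈ K.faces, s.card = d + 1 ∧ ∃ x ∈ convexHull ℝ (s : Set (Amb d)),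
    x ≠ 0 ∧ NormedSpace.normalize x = p

theorem RadiallyHomeomorphic.radiallyCovers {X : Set (Amb d)}
    (h : RadiallyHomeomorphic (delaunay X)) : RadiallyCovers (delaunay X) := by
  obtain ⟨e, he⟩ := h
  intro p hp
  obtain ⟨x, hx⟩ := e.surjective ⟨p, hp⟩
  have hxp : NormedSpace.normalize (x : Amb d) = p := by rw [← he, hx]
  obtain ⟨s, hs, hxs⟩ := Set.mem_iUnion₂.1 x.2
  obtain ⟨hne, t, htX, htc, hte, hst⟩ := hs
  refine ⟨t, ⟨hne.mono hst, t, htX, htc, hte, subset_rfl⟩, htc, x, convexHull_mono hst hxs, ?_, hxp⟩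
  intro h0
  rw [h0, NormedSpace.normalize_zero_eq_zero] at hxp
  simp [← hxp] at hp

/-- A set of vertices on a supporting hyperplane of the convex hull has the empty circle
property. -/
theorem emptyCircle_of_support {X : Set (Amb d)} (hX : X ⊆ Sph d) {c : Amb d} (hc0 : c ≠ 0)
    (hc : ∀ x ∈ X, inner ℝ c x ≤ 1) {t : Finset (Amb d)}
    (ht : (t : Set (Amb d)) ⊆ {x ∈ X | inner ℝ c x = 1}) : EmptyCircle X t := by
  have hn : ‖NormedSpace.normalize c‖ = 1 := NormedSpace.norm_normalize_eq_one_iff.2 hc0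
  have hcpos : 0 < ‖c‖ := norm_pos_iff.2 hc0
  -- On the sphere, maximizing the height over the hyperplane direction means minimizing the
  -- distance to its pole.
  have hsq : ∀ x ∈ X, ‖NormedSpace.normalize c - x‖ ^ 2 = 2 - 2 * (inner ℝ c x / ‖c‖) := by
    intro x hx
    have hx1 : ‖x‖ = 1 := by simpa using hX hx
    have hi : inner ℝ c x = ‖c‖ * inner ℝ (NormedSpace.normalize c) x := by
      conv_lhs => rw [← NormedSpace.norm_smul_normalize c, real_inner_smul_left]
    rw [norm_sub_sq_real, hn, hx1, hi, mul_div_cancel_left₀ _ hcpos.ne']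
    ring
  have hle : ∀ v ∈ t, ∀ x ∈ X,
      geoDist (NormedSpace.normalize c) v ≤ geoDist (NormedSpace.normalize c) x := by
    intro v hv x hx
    obtain ⟨hvX, hv1⟩ := ht hv
    rw [geoDist_le_geoDist_iff (by simpa using hn) (hX hvX) (hX hx),
      ← sq_le_sq₀ (norm_nonneg _) (norm_nonneg _), hsq v hvX, hsq x hx, hv1]
    have : inner ℝ c x / ‖c‖ ≤ 1 / ‖c‖ := by gcongr; exact hc x hx
    linarith
  refine ⟨NormedSpace.normalize c, by simpa using hn, ?_⟩
  rcases t.eq_empty_or_nonempty with rfl | ⟨v₀, hv₀⟩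
  · refine ⟨0, by simp, fun x _ => ?_⟩
    exact mul_nonneg zero_le_two (Real.arcsin_nonneg.2 (by positivity))
  · exact ⟨geoDist (NormedSpace.normalize c) v₀,
      fun v hv => le_antisymm (hle v hv v₀ (ht hv₀).1) (hle v₀ hv₀ v (ht hv).1), hle v₀ hv₀⟩

/-- The Delaunay complex of a dense set covers the sphere. -/
theorem radiallyCovers_of_dense {X : Set (Amb d)} (hfin : X.Finite) (hX : X ⊆ Sph d)
    (hdense : ∀ p ∈ Sph d, ∃ x ∈ X, ‖p - x‖ ≤ 1) : RadiallyCovers (delaunay X) := by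
  -- For unit vectors, chord at most `1` means inner product at least `1 / 2`.
  have hdense' : ∀ e : Amb d, ‖e‖ = 1 → ∃ x ∈ X, 1 / 2 ≤ inner ℝ e x := by
    intro e he
    obtain ⟨x, hx, hle⟩ := hdense e (by simpa using he)
    refine ⟨x, hx, ?_⟩
    have hx1 : ‖x‖ = 1 := by simpa using hX hx
    have h := norm_sub_sq_real e x
    rw [he, hx1] at h
    nlinarith [norm_nonneg (e - x)]
  intro p hp
  have hp1 : ‖p‖ = 1 := by simpa using hp
  obtain ⟨x₀, hx₀, -⟩ := hdense p hp
  obtain ⟨τ, hτ, hy, c₀, hc₀, hc₀y⟩ := exists_exit_point hfin (by norm_num)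
    (ball_subset_convexHull hfin ⟨x₀, hx₀⟩ hdense') hp1
  obtain ⟨c, hc, hcy, hspan⟩ := exists_support_span_eq_top hfin
    (fun c hc => norm_le_two_of_inner_le_one hdense' hc) hy hc₀ hc₀y
  obtain ⟨t, ht, htc, hyt⟩ := exists_basis_mem_convexHull (hfin.subset (Set.sep_subset _ _))
    (fun x hx => hx.2) hspan (mem_convexHull_active hfin hy hc hcy)
  rw [finrank_euclideanSpace_fin] at htc
  have hc0 : c ≠ 0 := by
    rintro rfl
    simp at hcy
  have hp0 : p ≠ 0 := by
    rintro rfl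
    simp at hp1
  refine ⟨t, ⟨Finset.card_pos.1 (by omega), t, fun x hx => (ht hx).1, htc,
    emptyCircle_of_support hX hc0 hc ht, subset_rfl⟩, htc, τ • p, hyt, smul_ne_zero hτ.ne' hp0, ?_⟩
  rw [NormedSpace.normalize_smul_of_pos hτ, NormedSpace.normalize_eq_self_of_norm_eq_one hp1]

end DelaunayCover

/-! ### Meshes and their contraction under subdivision. -/

section Subdivision

variable {d : ℕ}

/-- `X` is a finite subset of the sphere whose Delaunay complex covers the sphere and has edges of
length at most `δ`. -/
structure IsMesh (X : Set (Amb d)) (δ : ℝ) : Prop where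
  finite : X.Finite
  subset_sphere : X ⊆ Sph d
  covers : RadiallyCovers (delaunay X)
  norm_sub_le : ∀ s ∈ (delaunay X).faces, ∀ u ∈ s, ∀ v ∈ s, ‖u - v‖ ≤ δ

theorem card_le_of_mem_faces_delaunay {X : Set (Amb d)} {s : Finset (Amb d)}
    (hs : s ∈ (delaunay X).faces) : s.card ≤ d + 1 := by
  obtain ⟨-, t, -, htc, -, hst⟩ := hs
  exact htc ▸ Finset.card_le_card hst

theorem finite_faces_delaunay {X : Set (Amb d)} (hX : X.Finite) : (delaunay X).faces.Finite := by
  lift X to Finset (Amb d) using hX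
  refine (Finset.finite_toSet X.powerset).subset fun s hs => ?_
  exact Finset.mem_powerset.2 fun v hv => mem_of_mem_faces_delaunay hs hv

theorem one_sub_one_div_succ (d : ℕ) : 1 - 1 / ((d + 1 : ℕ) : ℝ) = (d : ℝ) / (d + 1) := by
  push_cast
  field_simp
  ring

theorem IsMesh.nonneg {X : Set (Amb d)} {δ : ℝ} (h : IsMesh X δ) : 0 ≤ δ := by
  obtain ⟨p, hp⟩ := NormedSpace.sphere_nonempty (x := (0 : Amb d)).2 zero_le_one
  obtain ⟨s, hs, -⟩ := h.covers p hp
  obtain ⟨v, hv⟩ := hs.1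
  simpa using h.norm_sub_le s hs v hv v hv

theorem IsMesh.le_norm {X : Set (Amb d)} {δ m : ℝ} (h : IsMesh X δ) (hm : 0 ≤ m)
    (hmδ : m ^ 2 ≤ 1 - 1 / 2 * ((d : ℝ) / (d + 1)) * δ ^ 2) {s : Finset (Amb d)}
    (hs : s ∈ (delaunay X).faces) {x : Amb d} (hx : x ∈ convexHull ℝ (s : Set (Amb d))) :
    m ≤ ‖x‖ := by
  have h1 := le_norm_sq_of_mem_convexHull (card_le_of_mem_faces_delaunay hs)
    (fun v hv => by simpa using h.subset_sphere (mem_of_mem_faces_delaunay hs hv))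
    (h.norm_sub_le s hs) hx
  rw [one_sub_one_div_succ] at h1
  exact (sq_le_sq₀ hm (norm_nonneg _)).1 (hmδ.trans h1)

/-- Refining a mesh by points that are dense in its simplices. -/
theorem IsMesh.refine {X B : Set (Amb d)} {δ m ρ : ℝ} (h : IsMesh X δ) (hm : 0 < m)
    (hmδ : m ^ 2 ≤ 1 - 1 / 2 * ((d : ℝ) / (d + 1)) * δ ^ 2) (hρ : ρ ≤ m) (hB : B.Finite)
    (hBX : ∀ b ∈ B, ∃ s ∈ (delaunay X).faces, b ∈ convexHull ℝ (s : Set (Amb d)))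
    (hnear : ∀ s ∈ (delaunay X).faces, s.card = d + 1 → ∀ x ∈ convexHull ℝ (s : Set (Amb d)),
      ∃ b ∈ B, ‖x - b‖ ≤ ρ) :
    IsMesh (NormedSpace.normalize '' B) (2 * (ρ / m)) := by
  have hBm : ∀ b ∈ B, m ≤ ‖b‖ := fun b hb => by
    obtain ⟨s, hs, hbs⟩ := hBX b hb
    exact h.le_norm hm.le hmδ hs hbs
  have hsub : NormedSpace.normalize '' B ⊆ Sph d := by
    rintro _ ⟨b, hb, rfl⟩
    have : b ≠ 0 := norm_pos_iff.1 (hm.trans_le (hBm b hb))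
    simpa using this
  have hdense : ∀ p ∈ Sph d, ∃ x ∈ NormedSpace.normalize '' B, ‖p - x‖ ≤ ρ / m := by
    intro p hp
    obtain ⟨s, hs, hsc, x, hx, -, rfl⟩ := h.covers p hp
    obtain ⟨b, hb, hxb⟩ := hnear s hs hsc x hx
    refine ⟨_, ⟨b, hb, rfl⟩, ?_⟩
    refine (norm_normalize_sub_normalize_le hm (h.le_norm hm.le hmδ hs hx) (hBm b hb)).trans ?_
    gcongr
  refine ⟨hB.image _, hsub, radiallyCovers_of_dense (hB.image _) hsub fun p hp => ?_,
    fun s hs u hu v hv => norm_sub_le_of_dense hsub hdense hs hu hv⟩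
  obtain ⟨x, hx, hle⟩ := hdense p hp
  exact ⟨x, hx, hle.trans ((div_le_one hm).2 hρ)⟩

theorem barycenter_mem_convexHull {s : Finset (Amb d)} (hs : s.Nonempty) :
    (s.card : ℝ)⁻¹ • ∑ v ∈ s, v ∈ convexHull ℝ (s : Set (Amb d)) := by
  rw [Finset.smul_sum]
  have hpos : (s.card : ℝ) ≠ 0 := by exact_mod_cast hs.card_pos.ne'
  exact (convex_convexHull ℝ _).sum_mem (fun _ _ => by positivity)
    (by rw [Finset.sum_const, nsmul_eq_mul, mul_inv_cancel₀ hpos])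
    fun v hv => subset_convexHull ℝ _ hv

/-- With `q = d / (d + 1)`, barycenters are `κ δ / 2`-dense as `q (q δ)² / 2 ≤ (κ δ / 2)²`. The
bound `hκm` keeps the projected density at most `1`, as covering requires. -/
theorem IsMesh.barycentric {X : Set (Amb d)} {δ m κ : ℝ} (h : IsMesh X δ) (hm : 0 < m)
    (hmδ : m ^ 2 ≤ 1 - 1 / 2 * ((d : ℝ) / (d + 1)) * δ ^ 2) (hκ : 0 ≤ κ)
    (hκd : 2 * ((d : ℝ) / (d + 1)) ^ 3 ≤ κ ^ 2) (hκm : κ * δ / 2 ≤ m) :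
    IsMesh (NormedSpace.normalize '' barycentricVertices (delaunay X)) (κ / m * δ) := by
  have key := h.refine (B := barycentricVertices (delaunay X)) hm hmδ hκm ?_ ?_ ?_
  · convert key using 1
    field_simp
  · refine ((finite_faces_delaunay h.finite).image
      (fun s : Finset (Amb d) => (s.card : ℝ)⁻¹ • ∑ v ∈ s, v)).subset ?_
    rintro _ ⟨s, hs, rfl⟩
    exact ⟨s, hs, rfl⟩
  · rintro _ ⟨s, hs, rfl⟩
    exact ⟨s, hs, barycenter_mem_convexHull hs.1⟩
  · intro s hs hsc x hx
    obtain ⟨S, hSs, hS, hle⟩ := exists_barycenter_near hsc.le h.nonneg (h.norm_sub_le s hs) hx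
    refine ⟨barycenter S,
      ⟨S, ((delaunay X).isRelLowerSet_faces hs).2 hSs hS, rfl⟩, ?_⟩
    have := h.nonneg
    rw [← sq_le_sq₀ (norm_nonneg _) (by positivity)]
    refine hle.trans ?_
    rw [one_sub_one_div_succ]
    nlinarith [mul_le_mul_of_nonneg_right hκd (sq_nonneg δ)]

theorem IsMesh.edgewise {X : Set (Amb d)} {δ m κ : ℝ} (hd : d ≤ 2) (h : IsMesh X δ) (hm : 0 < m)
    (hmδ : m ^ 2 ≤ 1 - 1 / 2 * ((d : ℝ) / (d + 1)) * δ ^ 2) (hκ : 0 ≤ κ)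
    (hκd : 1 / 2 * ((d : ℝ) / (d + 1)) ≤ κ ^ 2) (hκm : κ * δ / 2 ≤ m) :
    IsMesh (NormedSpace.normalize '' edgewiseVertices (delaunay X)) (κ / m * δ) := by
  have key := h.refine (B := edgewiseVertices (delaunay X)) hm hmδ hκm ?_ ?_ ?_
  · convert key using 1
    field_simp
  · have hV : (edgewiseVertices (delaunay X)) ⊆ X ∪ (fun p : Amb d × Amb d =>
        midpoint ℝ p.1 p.2) '' (X ×ˢ X) := by
      rintro v (hv | ⟨a, b, ⟨-, s, hs, ha, hb⟩, rfl⟩)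
      · exact Or.inl (mem_of_mem_faces_delaunay hv (Finset.mem_singleton_self v))
      · exact Or.inr ⟨(a, b), ⟨mem_of_mem_faces_delaunay hs ha, mem_of_mem_faces_delaunay hs hb⟩,
          rfl⟩
    exact (h.finite.union ((h.finite.prod h.finite).image _)).subset hV
  · rintro v (hv | ⟨a, b, ⟨-, s, hs, ha, hb⟩, rfl⟩)
    · exact ⟨{v}, hv, by simp⟩
    · exact ⟨s, hs, (convex_convexHull ℝ _).midpoint_mem (subset_convexHull ℝ _ ha)
        (subset_convexHull ℝ _ hb)⟩
  · intro s hs hsc x hx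
    obtain ⟨a, ha, b, hb, hle⟩ := exists_midpoint_near hsc.le (by omega) (h.norm_sub_le s hs) hx
    refine ⟨midpoint ℝ a b, ?_, ?_⟩
    -- The nearby midpoint may be degenerate, and is then a vertex.
    · by_cases hab : a = b
      · subst hab
        rw [midpoint_self]
        exact Or.inl (((delaunay X).isRelLowerSet_faces hs).2 (Finset.singleton_subset_iff.2 ha)
          (Finset.singleton_nonempty a))
      · exact Or.inr ⟨a, b, ⟨hab, s, hs, ha, hb⟩, rfl⟩
    · have := h.nonneg
      rw [← sq_le_sq₀ (norm_nonneg _) (by positivity)]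
      refine hle.trans ?_
      rw [one_sub_one_div_succ]
      nlinarith [mul_le_mul_of_nonneg_right hκd (sq_nonneg δ)]

/-- A subdivision that contracts meshes by a factor `θ` produces arbitrarily fine meshes. -/
theorem IsMesh.iterate
    {subdiv : PreAbstractSimplicialComplex (Amb d) → PreAbstractSimplicialComplex (Amb d)}
    {X : Set (Amb d)} {δ θ : ℝ} (hX : IsMesh X δ) (hθ0 : 0 ≤ θ) (hθ1 : θ ≤ 1)
    (hstep : ∀ Y η, η ≤ δ → IsMesh Y η →
      ∃ Z, subdiv (delaunay Y) = delaunay Z ∧ IsMesh Z (θ * η)) (k : ℕ) :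
    ∃ Y, subdiv^[k] (delaunay X) = delaunay Y ∧ IsMesh Y (θ ^ k * δ) := by
  induction k with
  | zero => exact ⟨X, rfl, by simpa using hX⟩
  | succ k ih =>
    obtain ⟨Y, hY, hm⟩ := ih
    obtain ⟨Z, hZ, hmZ⟩ := hstep Y _
      (mul_le_of_le_one_left hX.nonneg (pow_le_one₀ hθ0 hθ1)) hm
    refine ⟨Z, by rw [Function.iterate_succ_apply', hY, hZ], ?_⟩
    rwa [pow_succ', mul_assoc]

end Subdivision

/-! ### Open stars, Lebesgue numbers and the loop. -/

section Stars

variable {n : ℕ}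

theorem openSimplex_subset_convexHull {V : Type*} [AddCommGroup V] [Module ℝ V] (s : Finset V) :
    openSimplex s ⊆ convexHull ℝ (s : Set V) := by
  rintro x ⟨c, hc0, hc, rfl⟩
  exact (convex_convexHull ℝ _).sum_mem (fun v hv => (hc0 v hv).le) hc
    fun v hv => subset_convexHull ℝ _ hv

theorem exists_mem_openSimplex {V : Type*} [AddCommGroup V] [Module ℝ V] {s : Finset V} {x : V}
    (hx : x ∈ convexHull ℝ (s : Set V)) : ∃ t ⊆ s, t.Nonempty ∧ x ∈ openSimplex t := by
  classical
  obtain ⟨c, hc0, hc, hcx⟩ := Finset.mem_convexHull'.1 hx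
  have hpos : ∀ v ∈ s, c v ≠ 0 → 0 < c v := fun v hv h => lt_of_le_of_ne (hc0 v hv) h.symm
  rw [← Finset.sum_filter_of_ne (p := fun v => 0 < c v) hpos] at hc
  rw [← Finset.sum_filter_of_ne (p := fun v => 0 < c v)
    (fun v hv h => hpos v hv fun h0 => h (by rw [h0, zero_smul]))] at hcx
  refine ⟨s.filter (fun v => 0 < c v), Finset.filter_subset _ _, ?_, c,
    fun v hv => (Finset.mem_filter.1 hv).2, hc, hcx⟩
  rw [Finset.nonempty_iff_ne_empty]
  intro h
  rw [h] at hc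
  simp at hc

/-- Barycentric coordinates are unique: a vertex of `s` outside `t` would have both a positive and a
zero coordinate. -/
theorem subset_of_mem_openSimplex {V : Type*} [AddCommGroup V] [Module ℝ V] {s t : Finset V}
    (hs : AffineIndependent ℝ ((↑) : s → V)) (hts : t ⊆ s) {x : V} (hx : x ∈ openSimplex s)
    (hxt : x ∈ convexHull ℝ (t : Set V)) : s ⊆ t := by
  classical
  obtain ⟨c, hc0, hc, hcx⟩ := hx
  obtain ⟨b, hb0, hb, hbx⟩ := Finset.mem_convexHull'.1 hxt
  set b' : V → ℝ := fun v => if v ∈ t then b v else 0 with hb'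
  have hb's : ∑ v ∈ s, b' v = 1 := by
    rw [← Finset.sum_subset hts fun v _ hv => if_neg hv, ← hb]
    exact Finset.sum_congr rfl fun v hv => if_pos hv
  have hb'x : ∑ v ∈ s, b' v • v = x := by
    rw [← Finset.sum_subset hts fun v _ hv => by rw [hb']; simp [hv], ← hbx]
    exact Finset.sum_congr rfl fun v hv => by simp [hb', hv]
  intro v hv
  by_contra hvt
  have h := affineIndependent_iff.1 hs Finset.univ (fun v => c v - b' v)
    (by
      rw [Finset.sum_coe_sort s (fun v => c v - b' v), Finset.sum_sub_distrib, hc, hb's, sub_self])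
    (by
      rw [Finset.sum_coe_sort s (fun v => (c v - b' v) • v)]
      simp only [sub_smul, Finset.sum_sub_distrib, hcx, hb'x, sub_self])
    ⟨v, hv⟩ (Finset.mem_univ _)
  simp only [hb', hvt, if_false, sub_zero] at h
  exact (hc0 v hv).ne' h

variable {L : Geometry.SimplicialComplex ℝ (EuclideanSpace ℝ (Fin n))}

/-- The union of the simplices of `L` that do not contain `w`. -/
def antistar (L : Geometry.SimplicialComplex ℝ (EuclideanSpace ℝ (Fin n)))
    (w : EuclideanSpace ℝ (Fin n)) : Set (EuclideanSpace ℝ (Fin n)) :=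
  ⋃ s ∈ {s | s ∈ L.faces ∧ w ∉ s}, convexHull ℝ (s : Set (EuclideanSpace ℝ (Fin n)))

/-- Finiteness of `L` enters here; it makes the complements of antistars an open cover fit for
Lebesgue's lemma. -/
theorem isClosed_antistar (hL : L.faces.Finite) (w : EuclideanSpace ℝ (Fin n)) :
    IsClosed (antistar L w) :=
  (hL.subset (Set.sep_subset _ _)).isClosed_biUnion
    fun s _ => s.finite_toSet.isClosed_convexHull ℝ

theorem mem_openStarSpace_of_notMem_antistar {w x : EuclideanSpace ℝ (Fin n)} (hx : x ∈ L.space)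
    (hw : x ∉ antistar L w) : x ∈ openStarSpace L.toPreAbstractSimplicialComplex w := by
  obtain ⟨s, hs, hxs⟩ := L.mem_space_iff.1 hx
  obtain ⟨t, hts, ht, hxt⟩ := exists_mem_openSimplex hxs
  have htL : t ∈ L.faces := L.down_closed hs hts ht
  have hwt : w ∈ t := by
    by_contra hwt
    exact hw (Set.mem_biUnion (show t ∈ {s | s ∈ L.faces ∧ w ∉ s} from ⟨htL, hwt⟩)
      (openSimplex_subset_convexHull t hxt))
  exact Set.mem_biUnion (show t ∈ openStar L.toPreAbstractSimplicialComplex w from ⟨htL, hwt⟩) hxt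

/-- Any vertex `w` of the simplex carrying `x` in its interior works: a simplex containing `x` has
that carrier as a face. -/
theorem exists_notMem_antistar {x : EuclideanSpace ℝ (Fin n)} (hx : x ∈ L.space) :
    ∃ w ∈ L.vertices, x ∉ antistar L w := by
  obtain ⟨s, hs, hxs⟩ := L.mem_space_iff.1 hx
  obtain ⟨t, hts, ⟨w, hw⟩, hxt⟩ := exists_mem_openSimplex hxs
  have htL : t ∈ L.faces := L.down_closed hs hts ⟨w, hw⟩
  refine ⟨w, L.down_closed htL (Finset.singleton_subset_iff.2 hw) (Finset.singleton_nonempty w),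
    fun h => ?_⟩
  obtain ⟨u, ⟨huL, hwu⟩, hxu⟩ := Set.mem_iUnion₂.1 h
  classical
  have hinter := L.inter_subset_convexHull htL huL ⟨openSimplex_subset_convexHull t hxt, hxu⟩
  rw [← Finset.coe_inter] at hinter
  have := subset_of_mem_openSimplex (L.indep htL) Finset.inter_subset_left hxt hinter hw
  exact hwu (Finset.mem_inter.1 this).2

variable {d : ℕ}

/-- Lebesgue's number lemma for the preimages of the open stars. -/
theorem exists_lebesgue_number (hL : L.faces.Finite) (F : C(Sph d, L.space)) :
    ∃ r > 0, ∀ p : Sph d, ∃ w ∈ L.vertices, ∀ q : Sph d, ‖(q : Amb d) - p‖ < r →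
      (F q : EuclideanSpace ℝ (Fin n)) ∈ openStarSpace L.toPreAbstractSimplicialComplex w := by
  obtain ⟨r, hr, h⟩ := lebesgue_number_lemma_of_metric (s := (Set.univ : Set (Sph d)))
    (c := fun w : L.vertices => (fun p : Sph d => (F p : EuclideanSpace ℝ (Fin n))) ⁻¹'
      (antistar L w)ᶜ) isCompact_univ
    (fun w => (isClosed_antistar hL w).isOpen_compl.preimage
      (continuous_subtype_val.comp F.continuous))
    (fun p _ => by
      obtain ⟨w, hw, hp⟩ := exists_notMem_antistar (F p).2
      exact Set.mem_iUnion.2 ⟨⟨w, hw⟩, hp⟩)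
  refine ⟨r, hr, fun p => ?_⟩
  obtain ⟨w, hw⟩ := h p (Set.mem_univ p)
  refine ⟨w, w.2, fun q hq => mem_openStarSpace_of_notMem_antistar (F q).2 (hw ?_)⟩
  rwa [Metric.mem_ball, Subtype.dist_eq, dist_eq_norm]

theorem StarCondition.weakStarCondition {F : C(Sph d, L.space)}
    {K : PreAbstractSimplicialComplex (Amb d)} (h : StarCondition F K) : WeakStarCondition F K := by
  intro v hv
  obtain ⟨w, hw, hmaps⟩ := h v hv
  exact ⟨w, hw, fun u hu => hmaps u (Set.mem_biUnion hu (by simp))⟩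

/-- Sufficiently fine meshes satisfy the star condition. -/
theorem IsMesh.starCondition {F : C(Sph d, L.space)} {r : ℝ}
    (hr : ∀ p : Sph d, ∃ w ∈ L.vertices, ∀ q : Sph d, ‖(q : Amb d) - p‖ < r →
      (F q : EuclideanSpace ℝ (Fin n)) ∈ openStarSpace L.toPreAbstractSimplicialComplex w)
    {X : Set (Amb d)} {δ m : ℝ} (h : IsMesh X δ) (hm : 0 < m)
    (hmδ : m ^ 2 ≤ 1 - 1 / 2 * ((d : ℝ) / (d + 1)) * δ ^ 2) (hδr : δ / m < r) :
    StarCondition F (delaunay X) := by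
  intro v hv
  have hvS : v ∈ Sph d :=
    h.subset_sphere (mem_of_mem_faces_delaunay hv (Finset.mem_singleton_self v))
  obtain ⟨w, hw, hmaps⟩ := hr ⟨v, hvS⟩
  refine ⟨w, hw, fun x hx => ?_⟩
  obtain ⟨t, ⟨-, s, ⟨hs, hvs⟩, hts⟩, hxt⟩ := Set.mem_iUnion₂.1 hx
  have hxs := convexHull_mono (Finset.coe_subset.2 hts) hxt
  have hxm := h.le_norm hm.le hmδ hs hxs
  refine ⟨norm_pos_iff.1 (hm.trans_le hxm), hmaps _ ?_⟩
  have hv1 : NormedSpace.normalize v = v :=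
    NormedSpace.normalize_eq_self_of_norm_eq_one (by simpa using hvS)
  have hxv : ‖x - v‖ ≤ δ := by
    have hball : convexHull ℝ (s : Set (Amb d)) ⊆ Metric.closedBall v δ :=
      convexHull_min (fun u hu => by simpa [dist_eq_norm] using h.norm_sub_le s hs u hu v hvs)
        (convex_closedBall v δ)
    simpa [dist_eq_norm] using hball hxs
  have hlip := norm_normalize_sub_normalize_le hm hxm
    (h.le_norm hm.le hmδ hs (subset_convexHull ℝ _ hvs))
  rw [hv1] at hlip
  calc ‖NormedSpace.normalize x - v‖ ≤ ‖x - v‖ / m := hlip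
    _ ≤ δ / m := by gcongr
    _ < r := hδr

/-- The loop may stop before round `k`, so only the exit test is known of the final state. -/
theorem exists_whileLoop {S : Type*} {exitTest : S → Prop} {step : S → S} (k : ℕ) :
    ∀ s, exitTest (step^[k] s) → ∃ t, WhileLoop exitTest step s t ∧ exitTest t := by
  induction k with
  | zero => exact fun s h => ⟨s, .exit h, h⟩
  | succ k ih =>
    intro s h
    by_cases hs : exitTest s
    · exact ⟨s, .exit hs, hs⟩
    · obtain ⟨t, ht, hte⟩ := ih (step s) h
      exact ⟨t, .iterate hs ht, hte⟩

theorem algorithmTerminates_of_iterate {F : C(Sph d, L.space)}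
    {exitTest : PreAbstractSimplicialComplex (Amb d) → Prop}
    {subdiv : PreAbstractSimplicialComplex (Amb d) → PreAbstractSimplicialComplex (Amb d)}
    {K : PreAbstractSimplicialComplex (Amb d)}
    (hexit : ∀ K', exitTest K' → WeakStarCondition F K') (k : ℕ)
    (hk : exitTest (subdiv^[k] K)) : AlgorithmTerminates F exitTest subdiv K := by
  obtain ⟨K', hloop, hK'⟩ := exists_whileLoop k K hk
  choose g hg hmaps using hexit K' hK'
  exact ⟨K', hloop, fun v => ⟨g v v.2, hg v v.2⟩, fun v => hmaps v v.2⟩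

/-- If a subdivision contracts meshes, then the algorithm terminates. -/
theorem IsMesh.algorithmTerminates (hL : L.faces.Finite) (F : C(Sph d, L.space))
    {subdiv : PreAbstractSimplicialComplex (Amb d) → PreAbstractSimplicialComplex (Amb d)}
    {X : Set (Amb d)} {δ θ m : ℝ} (hX : IsMesh X δ) (hm : 0 < m)
    (hmδ : m ^ 2 ≤ 1 - 1 / 2 * ((d : ℝ) / (d + 1)) * δ ^ 2) (hθ0 : 0 ≤ θ) (hθ1 : θ < 1)
    (hstep : ∀ Y η, η ≤ δ → IsMesh Y η →
      ∃ Z, subdiv (delaunay Y) = delaunay Z ∧ IsMesh Z (θ * η)) :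
    AlgorithmTerminates F (StarCondition F) subdiv (delaunay X) ∧
      AlgorithmTerminates F (WeakStarCondition F) subdiv (delaunay X) := by
  obtain ⟨r, hr, hleb⟩ := exists_lebesgue_number hL F
  have htend : Filter.Tendsto (fun k : ℕ => θ ^ k * δ / m) Filter.atTop (nhds (0 * δ / m)) :=
    ((tendsto_pow_atTop_nhds_zero_of_lt_one hθ0 hθ1).mul_const δ).div_const m
  rw [zero_mul, zero_div] at htend
  obtain ⟨k, hk⟩ := (htend.eventually_lt_const hr).exists
  obtain ⟨Y, hY, hmesh⟩ := hX.iterate hθ0 hθ1.le hstep k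
  have hδk : θ ^ k * δ ≤ δ := mul_le_of_le_one_left hX.nonneg (pow_le_one₀ hθ0 hθ1.le)
  have hstar : StarCondition F (subdiv^[k] (delaunay X)) := by
    rw [hY]
    refine hmesh.starCondition hleb hm (hmδ.trans ?_) hk
    have := hmesh.nonneg
    gcongr
  exact ⟨algorithmTerminates_of_iterate (fun _ h => h.weakStarCondition) k hstar,
    algorithmTerminates_of_iterate (fun _ h => h) k hstar.weakStarCondition⟩

end Stars

/-! ### Numerical bounds and the theorem. -/

section Main

variable {d : ℕ}

theorem pos_of_isGreatest_edgeLengths {K : PreAbstractSimplicialComplex (Amb d)} {δ : ℝ}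
    (hδ : IsGreatest (edgeLengths K) δ) : 0 < δ := by
  obtain ⟨u, v, ⟨huv, -⟩, rfl⟩ := hδ.1
  exact norm_pos_iff.2 (sub_ne_zero.2 huv)

theorem le_two_of_isGreatest_edgeLengths {X : Set (Amb d)} (hX : X ⊆ Sph d) {δ : ℝ}
    (hδ : IsGreatest (edgeLengths (delaunay X)) δ) : δ ≤ 2 := by
  obtain ⟨u, v, ⟨-, s, hs, hu, hv⟩, rfl⟩ := hδ.1
  have hu1 : ‖u‖ = 1 := by simpa using hX (mem_of_mem_faces_delaunay hs hu)
  have hv1 : ‖v‖ = 1 := by simpa using hX (mem_of_mem_faces_delaunay hs hv)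
  linarith [norm_sub_le u v]

theorem isMesh_of_isGreatest {X : Set (Amb d)} (hfin : X.Finite) (hX : X ⊆ Sph d)
    (hK : RadiallyHomeomorphic (delaunay X)) {δ : ℝ}
    (hδ : IsGreatest (edgeLengths (delaunay X)) δ) : IsMesh X δ := by
  refine ⟨hfin, hX, hK.radiallyCovers, fun s hs u hu v hv => ?_⟩
  by_cases huv : u = v
  · simpa [huv] using (pos_of_isGreatest_edgeLengths hδ).le
  · exact hδ.2 ⟨u, v, ⟨huv, s, hs, hu, hv⟩, rfl⟩

theorem sq_le_of_sq_le {q m δ η : ℝ} (hq : 0 ≤ q) (hm : m ^ 2 ≤ 1 - 1 / 2 * q * δ ^ 2)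
    (hη0 : 0 ≤ η) (hη : η ≤ δ) : m ^ 2 ≤ 1 - 1 / 2 * q * η ^ 2 := by
  refine hm.trans ?_
  gcongr

theorem dim_ratio_le {d k : ℕ} (hd : d ≤ k) : (d : ℝ) / (d + 1) ≤ k / (k + 1) := by
  have : (d : ℝ) ≤ k := by exact_mod_cast hd
  rw [div_le_div_iff₀ (by positivity) (by positivity)]
  nlinarith

theorem sq_barycentric_factor {q : ℝ} (hq : 0 ≤ q) : (√2 * q ^ (3 / 2 : ℝ)) ^ 2 = 2 * q ^ 3 := by
  rw [mul_pow, Real.sq_sqrt zero_le_two, ← Real.rpow_natCast, ← Real.rpow_mul hq,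
    ← Real.rpow_natCast q 3]
  norm_num

end Main

end SphericalDelaunay

end

open SphericalDelaunay in
theorem mainTheorem6 {d n : ℕ} (hd : 1 ≤ d)
    (X : Set (Amb d)) (hfin : X.Finite) (hX : X ⊆ Sph d)
    (hK : RadiallyHomeomorphic (delaunay X))
    (δ : ℝ) (hδ : IsGreatest (edgeLengths (delaunay X)) δ)
    (L : Geometry.SimplicialComplex ℝ (EuclideanSpace ℝ (Fin n))) (hL : L.faces.Finite)
    (F : C(Sph d, L.space)) :
    (d ≤ 3 →
      δ⁻¹ * ell d δ ≤ 1 / 4 * (1 - √2 * ((d : ℝ) / (d + 1)) ^ (3 / 2 : ℝ)) →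
        AlgorithmTerminates F (StarCondition F) delaunayBarycentric (delaunay X) ∧
        AlgorithmTerminates F (WeakStarCondition F) delaunayBarycentric (delaunay X)) ∧
    (d ≤ 2 → δ ≤ 1 / 2 →
        AlgorithmTerminates F (StarCondition F) delaunayEdgewise (delaunay X) ∧
        AlgorithmTerminates F (WeakStarCondition F) delaunayEdgewise (delaunay X)) := by
  have hmesh := isMesh_of_isGreatest hfin hX hK hδ
  have hδ0 := pos_of_isGreatest_edgeLengths hδ
  have hδ2 := le_two_of_isGreatest_edgeLengths hX hδ
  have hq0 : (0 : ℝ) ≤ (d : ℝ) / (d + 1) := by positivity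
  have hmsq : 0 < √(1 - 1 / 2 * ((d : ℝ) / (d + 1)) * δ ^ 2) →
      √(1 - 1 / 2 * ((d : ℝ) / (d + 1)) * δ ^ 2) ^ 2 = 1 - 1 / 2 * ((d : ℝ) / (d + 1)) * δ ^ 2 :=
    fun h => Real.sq_sqrt (Real.sqrt_pos.1 h).le
  constructor
  · intro hd3 hell
    have hq : (d : ℝ) / (d + 1) ≤ 3 / 4 := by have := dim_ratio_le hd3; norm_num at this ⊢; exact this
    have hκ2 := sq_barycentric_factor hq0
    have hκ0 : 0 ≤ √2 * ((d : ℝ) / (d + 1)) ^ (3 / 2 : ℝ) := by positivity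
    unfold ell at hell
    set m := √(1 - 1 / 2 * ((d : ℝ) / (d + 1)) * δ ^ 2)
    set κ := √2 * ((d : ℝ) / (d + 1)) ^ (3 / 2 : ℝ)
    -- `κ² ≤ 2 (3 / 4)³ = 27 / 32`; this is where `d ≤ 3` matters.
    have hκ1 : κ < 1 := by
      have : ((d : ℝ) / (d + 1)) ^ 3 ≤ (3 / 4) ^ 3 := by gcongr
      nlinarith
    -- As `δ ≤ 2`, the hypothesis gives `1 - m ≤ δ (1 - κ) / 4 ≤ (1 - κ) / 2 < 1 - κ`.
    have hκm : κ < m := by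
      rw [inv_mul_le_iff₀ hδ0] at hell
      nlinarith
    have hm : 0 < m := hκ0.trans_lt hκm
    refine hmesh.algorithmTerminates hL F hm (hmsq hm).le (div_nonneg hκ0 hm.le)
      ((div_lt_one hm).2 hκm) fun Y η hη hY => ⟨_, rfl, ?_⟩
    -- The last condition holds since `η ≤ δ ≤ 2` gives `κ η / 2 ≤ κ < m`.
    exact hY.barycentric hm (sq_le_of_sq_le hq0 (hmsq hm).le hY.nonneg hη) hκ0 hκ2.ge
      (by nlinarith [hY.nonneg])
  · intro hd2 hδ'
    have hq : (d : ℝ) / (d + 1) ≤ 2 / 3 := by have := dim_ratio_le hd2; norm_num at this ⊢; exact this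
    have hpos : 11 / 12 ≤ 1 - 1 / 2 * ((d : ℝ) / (d + 1)) * δ ^ 2 := by
      have : (d : ℝ) / (d + 1) * δ ^ 2 ≤ 2 / 3 * (1 / 2) ^ 2 := by gcongr
      linarith
    have hm : 0 < √(1 - 1 / 2 * ((d : ℝ) / (d + 1)) * δ ^ 2) := Real.sqrt_pos.2 (by linarith)
    -- Under the roots, at most `1 / 3` against at least `11 / 12`.
    have hκm : √(1 / 2 * ((d : ℝ) / (d + 1))) < √(1 - 1 / 2 * ((d : ℝ) / (d + 1)) * δ ^ 2) :=
      Real.sqrt_lt_sqrt (by positivity) (by linarith)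
    have hκ2 := Real.sq_sqrt (show 0 ≤ 1 / 2 * ((d : ℝ) / (d + 1)) by positivity)
    have hκ0 := Real.sqrt_nonneg (1 / 2 * ((d : ℝ) / (d + 1)))
    refine hmesh.algorithmTerminates hL F hm (hmsq hm).le (div_nonneg hκ0 hm.le)
      ((div_lt_one hm).2 hκm) fun Y η hη hY => ⟨_, rfl, ?_⟩
    exact hY.edgewise hd2 hm (sq_le_of_sq_le hq0 (hmsq hm).le hY.nonneg hη) hκ0 hκ2.ge
      (by nlinarith [hY.nonneg])
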